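/- **Conventions.** $\mathbb N=\{1,2,\dots\}$, and $r'=\frac{r}{r-1}$ is the Hölder conjugate of $r\in(1,\infty)$. A Rademacher family is a sequence $(r_j)_{j\in\mathbb N}$ of independent random variables with values in $\{-1,1\}$, each value having probability $\frac12$. A real normed space $F$ is of (Rademacher) type $p\in[1,2]$ if there is $\tau\in(0,\infty)$ such that $\bigl\|\sum_{j=1}^n r_jx_j\bigr\|_{L^p(\widetilde\Omega;F)}\le\tau\bigl(\sum_{j=1}^n\|x_j\|_F^p\bigr)^{1/p}$ for every Rademacher family $(r_j)_{j\in\mathbb N}$ on a probability space $\widetilde\Omega$, all $n\in\mathbb N$ and all $x_1,\dots,x_n\in F$; the infimum of these $\tau$ is the type $p$ constant $\tau_p(F)$. **Theorem.** Let $q\in(1,\infty)$, $\bar q:=\min\{q,2\}$, $\alpha,\gamma,C_\alpha,C_{\mathsf{stab}},C_\gamma,c_1,c_2\in(0,\infty)$, $a_0,a_1\in[0,\infty)$, $C_\tau\in[1,\infty)$ and $A\in(1,\infty)$. Then there is a constant $C\in(0,\infty)$, depending only on these numbers, such that the following holds. Let $p\in[1,2]$ with $p\le q$, let $E$ be a real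 Banach space of Rademacher type $p$, let $(\Omega,\mathcal A,\mathbb P)$ be a probability space, and let $X\in L^1(\Omega;E)$. Let $(E_\ell)_{\ell\in\mathbb N}$ be finite-dimensional subspaces of $E$ with dimensions $N_\ell:=\dim(E_\ell)$ such that $c_1A^\ell\le N_\ell\le c_2A^\ell$ for all $\ell\in\mathbb N$ and $$\sup_{\ell\in\mathbb N}\ \sup_{r\in[p,2]\cap(1,2]} N_\ell^{-(a_0-a_1r')}\,[\tau_r(E_\ell)]^{r'}\le C_\tau .$$ For every $\ell\in\mathbb N$ let $(X_{\ell,j})_{j\in\mathbb N}$ be a sequence of independent copies of a random variable $X_\ell\in L^q(\Omega;E_\ell)$, where $$\sup_{\ell\in\mathbb N}N_\ell^\alpha\,\bigl\|\mathbb E[X]-\mathbb E[X_\ell]\bigr\|_E\le C_\alpha,\qquad \sup_{\ell\in\mathbb N}\bigl\|X_\ell-\mathbb E[X_\ell]\bigr\|_{L^q(\Omega;E)}\le C_{\mathsf{stab}}.$$ Let $\mathcal C_\ell\ge 0$ be the cost of generating one sample of $X_\ell$, and assume $\mathcal C_\ell\le C_\gamma N_\ell^\gamma$ for all $\ell\in\mathbb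 N$. Then, for every $\epsilon\in(0,\frac12]$, there are $L,M_L\in\mathbb N$ such that the single-level Monte Carlo estimator satisfies $$\biggl\|\mathbb E[X]-\frac1{M_L}\sum_{j=1}^{M_L}X_{L,j}\biggr\|_{L^q(\Omega;E)}<\epsilon,$$ and its computational cost $\mathcal C^{\mathsf{SL}}_q(X):=M_L\,\mathcal C_L$ satisfies $$\mathcal C^{\mathsf{SL}}_q(X)\le C\cdot\begin{cases}\epsilon^{-\frac\gamma\alpha}+\epsilon^{-\bar q'-\frac{\gamma+a_0-a_1\bar q'}{\alpha}}&\text{if }\alpha\ge a_1,\\[2pt]\epsilon^{-\frac\gamma\alpha}+\epsilon^{-p'-\frac{\gamma+a_0-a_1p'}{\alpha}}&\text{if }\alpha<a_1\text{ and }p\in(1,2].\end{cases}$$ In particular, for $\alpha\ge a_1$ the bound does not depend on the type $p$. -/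

import Mathlib

open MeasureTheory ProbabilityTheory

universe u v

/-- `(r j)` is a Rademacher family: independent random variables with values in `{-1, 1}`, each
value being taken with probability `1/2`. -/
structure IsRademacherFamily {S : Type*} [MeasurableSpace S] (Q : Measure S)
    (r : ℕ → S → ℝ) : Prop where
  measurable : ∀ j, Measurable (r j)
  values : ∀ j s, r j s = 1 ∨ r j s = -1
  indep : iIndepFun r Q
  prob_one : ∀ j, Q {s | r j s = 1} = 1 / 2
  prob_neg_one : ∀ j, Q {s | r j s = -1} = 1 / 2

/-- The type `p` inequality with constant `τ`: for every Rademacher family on a probability space,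
every `n` and all vectors `x 0, …, x (n - 1)`,
`‖∑ r j • x j‖_{L^p} ≤ τ * (∑ ‖x j‖ ^ p) ^ (1 / p)`.
The left-hand side depends on the Rademacher family only through its law, so that probability
spaces in `Type` suffice. -/
def HasTypeConstant (E : Type*) [NormedAddCommGroup E] [NormedSpace ℝ E] (p τ : ℝ) : Prop :=
  ∀ (S : Type) [MeasurableSpace S] (Q : Measure S) [IsProbabilityMeasure Q] (r : ℕ → S → ℝ),
    IsRademacherFamily Q r → ∀ (n : ℕ) (x : ℕ → E),
      eLpNorm (fun s => ∑ j ∈ Finset.range n, r j s • x j) (ENNReal.ofReal p) Q ≤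
        ENNReal.ofReal (τ * (∑ j ∈ Finset.range n, ‖x j‖ ^ p) ^ (1 / p))

/-- `E` is of Rademacher type `p`. -/
def IsOfRademacherType (E : Type*) [NormedAddCommGroup E] [NormedSpace ℝ E] (p : ℝ) : Prop :=
  ∃ τ : ℝ, 0 < τ ∧ HasTypeConstant E p τ

/-- The type `p` constant `τ_p(E)`, as an extended nonnegative number; it is `∞` exactly when `E`
is not of type `p`. -/
noncomputable def typeConstant (E : Type*) [NormedAddCommGroup E] [NormedSpace ℝ E] (p : ℝ) :
    ENNReal :=
  sInf (ENNReal.ofReal '' {τ : ℝ | 0 < τ ∧ HasTypeConstant E p τ})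

/-- Growth of the type constants of the finite-dimensional subspaces `V ℓ`:
`(dim V ℓ) ^ (-(a₀ - a₁ r')) * τ_r(V ℓ) ^ r' ≤ Cτ` for all `ℓ` and all `r ∈ [p, 2] ∩ (1, 2]`,
where `r' = r / (r - 1)` is the Hölder conjugate of `r`. -/
def TypeConstantGrowth {E : Type*} [NormedAddCommGroup E] [NormedSpace ℝ E]
    (V : ℕ+ → Submodule ℝ E) (p a₀ a₁ Cτ : ℝ) : Prop :=
  ∀ ℓ : ℕ+, ∀ r ∈ Set.Icc p 2 ∩ Set.Ioc 1 2,
    ENNReal.ofReal ((Module.finrank ℝ (V ℓ) : ℝ) ^ (-(a₀ - a₁ * r.conjExponent))) *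
      typeConstant (V ℓ) r ^ r.conjExponent ≤ ENNReal.ofReal Cτ

/-- The `L^q(Ω; E)`-error of the single-level Monte Carlo estimator for `𝔼[X]` that averages the
first `M` members of the sequence `Y` of samples. -/
noncomputable def slmcError {Ω E : Type*} [MeasurableSpace Ω] [NormedAddCommGroup E]
    [NormedSpace ℝ E] (P : Measure Ω) (q : ℝ) (X : Ω → E) (Y : ℕ → Ω → E) (M : ℕ) : ENNReal :=
  eLpNorm (fun ω => (∫ ω', X ω' ∂P) - (1 / (M : ℝ)) • ∑ j ∈ Finset.range M, Y j ω)
    (ENNReal.ofReal q) P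

/-- The cost of the single-level Monte Carlo estimator on level `L` with `M` samples, where one
sample on level `ℓ` costs `cost ℓ`. -/
def slmcCost (cost : ℕ+ → ℝ) (L : ℕ+) (M : ℕ) : ℝ := M * cost L

/-! The error on level `L` splits into the bias `𝔼[X] - 𝔼[X_L]` and the fluctuation of the empirical
mean. The latter is symmetrized: since `U` is a conditional expectation of `U + W` when `W` is
centred and independent of `U`, flipping signs in a sum of centred independent variables changes
its `L^q` norm by a factor of at most two, whence one may average over Rademacher signs. A
Rademacher sum concentrates around its mean (Azuma-Hoeffding), so that in a space with type `r`
constant `τ`, where `r ≤ 2`, its `L^q` norm is at most `q e^{3/2} τ (∑ ‖x j‖ ^ r) ^ (1 / r)`, which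
depends on `r` only through `τ` and the sum.

Hence a level of dimension `N` comparable to `ε ^ (-1 / α)` controls the bias, and `M` comparable
to `(B / ε) ^ r' * (Cτ * N ^ (a₀ - a₁ * r'))` samples, where `B` is a multiple of `q * Cstab`,
control the fluctuation. The resulting exponent `-r' - (γ + a₀ - a₁ r') / α` of `ε` is affine in
`r'` with slope `(a₁ - α) / α`: the best choice is `r = min q 2` if `a₁ ≤ α`. If `α < a₁`, it is
`r = p`, with `r'` unbounded as `p` tends to `1`; taking the factor in `N ≍ ε ^ (-1 / α)` large
enough that `B * N ^ (-a₁) ≤ ε ^ (a₁ / α)` then keeps the constant independent of `p`. -/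

/-! ### Elementary inequalities -/

theorem rpow_le_rpow_self_mul_exp {q t : ℝ} (hq : 0 < q) (ht : 0 ≤ t) :
    t ^ q ≤ q ^ q * Real.exp t := by
  have h : t / q ≤ Real.exp (t / q) := by linarith [Real.add_one_le_exp (t / q)]
  calc t ^ q = q ^ q * (t / q) ^ q := by
        rw [← Real.mul_rpow hq.le (by positivity), mul_div_cancel₀ _ hq.ne']
    _ ≤ q ^ q * Real.exp (t / q) ^ q := by gcongr
    _ = q ^ q * Real.exp t := by rw [← Real.exp_mul, div_mul_cancel₀ _ hq.ne']

theorem exp_add_exp_div_two_le (a b : ℝ) :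
    (Real.exp a + Real.exp b) / 2 ≤ Real.exp ((a + b) / 2 + (a - b) ^ 2 / 8) := by
  calc (Real.exp a + Real.exp b) / 2
      = Real.exp ((a + b) / 2) * Real.cosh ((a - b) / 2) := by
        rw [Real.cosh_eq, mul_div_assoc', mul_add, ← Real.exp_add, ← Real.exp_add]
        ring_nf
    _ ≤ Real.exp ((a + b) / 2) * Real.exp (((a - b) / 2) ^ 2 / 2) := by
        gcongr
        exact Real.cosh_le_exp_half_sq _
    _ = Real.exp ((a + b) / 2 + (a - b) ^ 2 / 8) := by
        rw [← Real.exp_add]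
        ring_nf

theorem sum_rpow_le_rpow_sum {ι : Type*} (s : Finset ι) {a : ι → ℝ} (ha : ∀ i, 0 ≤ a i) {p : ℝ}
    (hp : 1 ≤ p) : ∑ i ∈ s, a i ^ p ≤ (∑ i ∈ s, a i) ^ p := by
  classical
  induction s using Finset.induction_on with
  | empty => simp [Real.zero_rpow (by linarith : p ≠ 0)]
  | insert i s hi ih =>
    rw [Finset.sum_insert hi, Finset.sum_insert hi]
    calc a i ^ p + ∑ j ∈ s, a j ^ p ≤ a i ^ p + (∑ j ∈ s, a j) ^ p := by gcongr
      _ ≤ (a i + ∑ j ∈ s, a j) ^ p :=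
        Real.add_rpow_le_rpow_add (ha i) (Finset.sum_nonneg fun j _ => ha j) hp

theorem exists_natCast_rpow_mul_le {s κ δ : ℝ} (hs : 0 < s) (hκ : 0 < κ) (hδ : 0 < δ) :
    ∃ M : ℕ, 1 ≤ M ∧ (M : ℝ) ^ (-s⁻¹) * κ ≤ δ ∧ (M : ℝ) ≤ (κ / δ) ^ s + 1 := by
  have hx : 0 < (κ / δ) ^ s := by positivity
  have hM : (κ / δ) ^ s ≤ (⌈(κ / δ) ^ s⌉₊ : ℝ) := Nat.le_ceil _
  refine ⟨⌈(κ / δ) ^ s⌉₊, Nat.ceil_pos.mpr hx, ?_, (Nat.ceil_lt_add_one hx.le).le⟩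
  calc (⌈(κ / δ) ^ s⌉₊ : ℝ) ^ (-s⁻¹) * κ ≤ ((κ / δ) ^ s) ^ (-s⁻¹) * κ := by
        gcongr ?_ * κ
        exact Real.rpow_le_rpow_of_nonpos hx hM (by simpa using hs.le)
    _ = δ := by
        rw [Real.rpow_neg (by positivity), Real.rpow_rpow_inv (by positivity) hs.ne', inv_div,
          div_mul_cancel₀ _ hκ.ne']

/-! ### Rademacher sums -/

theorem exists_isRademacherFamily :
    ∃ (S : Type) (_ : MeasurableSpace S) (Q : Measure S) (_ : IsProbabilityMeasure Q)
      (r : ℕ → S → ℝ), IsRademacherFamily Q r := by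
  let μ : Measure Bool := (PMF.uniformOfFintype Bool).toMeasure
  let sign : Bool → ℝ := fun b => if b then 1 else -1
  have h_sign : Measurable sign := measurable_from_top
  have h_coord (j : ℕ) (b : Bool) :
      Measure.infinitePi (fun _ : ℕ => μ) {s | s j = b} = 1 / 2 := by
    calc Measure.infinitePi (fun _ : ℕ => μ) {s | s j = b}
        = (Measure.infinitePi fun _ : ℕ => μ).map (fun s => s j) {b} := by
          rw [Measure.map_apply (measurable_pi_apply j) (measurableSet_singleton b)]
          rfl
      _ = 1 / 2 := by
          rw [Measure.infinitePi_map_eval (fun _ : ℕ => μ) j,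
            PMF.toMeasure_apply_singleton _ _ (measurableSet_singleton b)]
          simp
  have h_one (b : Bool) : sign b = 1 ↔ b = true := by cases b <;> simp [sign]; norm_num
  have h_neg_one (b : Bool) : sign b = -1 ↔ b = false := by cases b <;> simp [sign]; norm_num
  refine ⟨ℕ → Bool, inferInstance, Measure.infinitePi fun _ => μ, inferInstance,
    fun j s => sign (s j), fun j => h_sign.comp (measurable_pi_apply j), fun j s => ?_,
    iIndepFun_infinitePi fun _ => h_sign, fun j => ?_, fun j => ?_⟩
  · rw [h_one, h_neg_one]
    exact Bool.eq_false_or_eq_true (s j)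
  · simpa only [h_one] using h_coord j true
  · simpa only [h_neg_one] using h_coord j false

namespace IsRademacherFamily

variable {S : Type*} [MeasurableSpace S] {Q : Measure S} {ρ : ℕ → S → ℝ}

theorem abs_eq_one (hρ : IsRademacherFamily Q ρ) (j : ℕ) (s : S) : |ρ j s| = 1 := by
  rcases hρ.values j s with h | h <;> simp [h]

variable [IsProbabilityMeasure Q]

theorem integral_eq_zero (hρ : IsRademacherFamily Q ρ) (j : ℕ) : ∫ s, ρ j s ∂Q = 0 := by
  have h_meas : MeasurableSet {s | ρ j s = 1} := hρ.measurable j (measurableSet_singleton 1)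
  have h_indicator (s : S) : ρ j s = 2 * {s | ρ j s = 1}.indicator 1 s - 1 := by
    rcases hρ.values j s with h | h <;> simp [Set.indicator, h] <;> norm_num
  calc ∫ s, ρ j s ∂Q = ∫ s, (2 * {s | ρ j s = 1}.indicator 1 s - 1) ∂Q :=
        integral_congr_ae (.of_forall h_indicator)
    _ = 2 * Q.real {s | ρ j s = 1} - 1 := by
        rw [integral_sub (((integrable_const 1).indicator h_meas).const_mul 2)
          (integrable_const 1), integral_const_mul, integral_indicator_one h_meas]
        simp
    _ = 0 := by simp [Measure.real, hρ.prob_one j]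

variable {V : Type*} [NormedAddCommGroup V] [NormedSpace ℝ V]

theorem integrable_comp_sum (hρ : IsRademacherFamily Q ρ) {F : V → ℝ} (hF : Continuous F)
    (n : ℕ) (x : ℕ → V) (y : V) :
    Integrable (fun s => F (y + ∑ j ∈ Finset.range n, ρ j s • x j)) Q := by
  let G : (Finset.range n → ℝ) → ℝ := fun z => F (y + ∑ j, z j • x j)
  have hG : Continuous G := by fun_prop
  obtain ⟨C, hC⟩ := (isCompact_closedBall (0 : Finset.range n → ℝ) 1).exists_bound_of_continuousOn
    hG.continuousOn
  have h_mem (s : S) : (fun j : Finset.range n => ρ j s) ∈ Metric.closedBall 0 1 := by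
    rw [mem_closedBall_zero_iff, pi_norm_le_iff_of_nonneg zero_le_one]
    exact fun j => (hρ.abs_eq_one j s).le
  have h_int : Integrable (fun s => G fun j => ρ j s) Q :=
    .of_bound (hG.measurable.comp
      (measurable_pi_lambda _ fun j => hρ.measurable j)).aestronglyMeasurable C
      (.of_forall fun s => hC _ (h_mem s))
  have h_sum (s : S) : ∑ j : Finset.range n, ρ j s • x j = ∑ j ∈ Finset.range n, ρ j s • x j :=
    Finset.sum_coe_sort (Finset.range n) fun j => ρ j s • x j
  simpa only [G, h_sum] using h_int

theorem integral_mul_comp_sum_eq_zero (hρ : IsRademacherFamily Q ρ) {F : V → ℝ}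
    (hF : Continuous F) (n : ℕ) (x : ℕ → V) (y : V) :
    ∫ s, ρ n s * F (y + ∑ j ∈ Finset.range n, ρ j s • x j) ∂Q = 0 := by
  let G : (Finset.range n → ℝ) → ℝ := fun z => F (y + ∑ j, z j • x j)
  have hG : Measurable G := Continuous.measurable (by fun_prop)
  have h_indep : IndepFun (ρ n) (fun s => G fun j => ρ j s) Q :=
    (hρ.indep.indepFun_finset {n} (Finset.range n) (by simp) hρ.measurable).comp
      (φ := fun z : ({n} : Finset ℕ) → ℝ => z ⟨n, Finset.mem_singleton_self n⟩)
      (measurable_pi_apply _) hG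
  have h_mul := h_indep.integral_fun_mul_eq_mul_integral
    (hρ.measurable n).aestronglyMeasurable
    (hG.comp (measurable_pi_lambda _ fun j => hρ.measurable j)).aestronglyMeasurable
  rw [hρ.integral_eq_zero, zero_mul] at h_mul
  have h_sum (s : S) : ∑ j : Finset.range n, ρ j s • x j = ∑ j ∈ Finset.range n, ρ j s • x j :=
    Finset.sum_coe_sort (Finset.range n) fun j => ρ j s • x j
  simpa only [G, h_sum] using h_mul

theorem integral_comp_sum_succ (hρ : IsRademacherFamily Q ρ) {F : V → ℝ} (hF : Continuous F)
    (n : ℕ) (x : ℕ → V) (y : V) :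
    ∫ s, F (y + ∑ j ∈ Finset.range (n + 1), ρ j s • x j) ∂Q =
      (∫ s, F (y + x n + ∑ j ∈ Finset.range n, ρ j s • x j) ∂Q +
        ∫ s, F (y - x n + ∑ j ∈ Finset.range n, ρ j s • x j) ∂Q) / 2 := by
  let G (w : V) (s : S) : ℝ := F (w + ∑ j ∈ Finset.range n, ρ j s • x j)
  have hG (w : V) : Integrable (G w) Q := hρ.integrable_comp_sum hF n x w
  have hρG (w : V) : Integrable (fun s => ρ n s * G w s) Q :=
    (hG w).bdd_mul (c := 1) (hρ.measurable n).aestronglyMeasurable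
      (.of_forall fun s => (hρ.abs_eq_one n s).le)
  have h_split (s : S) : F (y + ∑ j ∈ Finset.range (n + 1), ρ j s • x j) =
      ((G (y + x n) s + G (y - x n) s) + (ρ n s * G (y + x n) s - ρ n s * G (y - x n) s)) / 2 := by
    rw [Finset.sum_range_succ, add_comm (∑ j ∈ Finset.range n, ρ j s • x j), ← add_assoc]
    rcases hρ.values n s with h | h
    · rw [h, one_smul]
      ring
    · rw [h, neg_one_smul, ← sub_eq_add_neg]
      ring
  rw [integral_congr_ae (.of_forall h_split), integral_div, integral_add, integral_add,
    integral_sub, hρ.integral_mul_comp_sum_eq_zero hF, hρ.integral_mul_comp_sum_eq_zero hF,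
    sub_zero, add_zero]
  exacts [hρG _, hρG _, hG _, hG _, (hG _).add (hG _), (hρG _).sub (hρG _)]

theorem abs_integral_norm_sub_integral_norm_le (hρ : IsRademacherFamily Q ρ) (n : ℕ)
    (x : ℕ → V) (y z : V) :
    |∫ s, ‖y + ∑ j ∈ Finset.range n, ρ j s • x j‖ ∂Q -
      ∫ s, ‖z + ∑ j ∈ Finset.range n, ρ j s • x j‖ ∂Q| ≤ ‖y - z‖ := by
  have h_int := hρ.integrable_comp_sum continuous_norm n x
  rw [← integral_sub (h_int y) (h_int z)]
  have h_le (s : S) : ‖‖y + ∑ j ∈ Finset.range n, ρ j s • x j‖ -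
      ‖z + ∑ j ∈ Finset.range n, ρ j s • x j‖‖ ≤ ‖y - z‖ :=
    (abs_norm_sub_norm_le _ _).trans_eq (by rw [add_sub_add_right_eq_sub])
  simpa using norm_integral_le_of_norm_le_const (μ := Q) (.of_forall h_le)

-- Each step of the induction is the bounded-differences form of the Azuma-Hoeffding argument.
theorem integral_exp_norm_le (hρ : IsRademacherFamily Q ρ) (c : ℝ) (n : ℕ) (x : ℕ → V) (y : V) :
    ∫ s, Real.exp (c * ‖y + ∑ j ∈ Finset.range n, ρ j s • x j‖) ∂Q ≤
      Real.exp (c * ∫ s, ‖y + ∑ j ∈ Finset.range n, ρ j s • x j‖ ∂Q +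
        c ^ 2 / 2 * ∑ j ∈ Finset.range n, ‖x j‖ ^ 2) := by
  induction n generalizing y with
  | zero => simp
  | succ n ih =>
    rw [hρ.integral_comp_sum_succ (F := fun v => Real.exp (c * ‖v‖)) (by fun_prop),
      hρ.integral_comp_sum_succ continuous_norm, Finset.sum_range_succ]
    have ih_add := ih (y + x n)
    have ih_sub := ih (y - x n)
    have h_diff := hρ.abs_integral_norm_sub_integral_norm_le n x (y + x n) (y - x n)
    rw [add_sub_sub_cancel, ← two_smul ℝ (x n), norm_smul, Real.norm_two] at h_diff
    set a := ∫ s, ‖y + x n + ∑ j ∈ Finset.range n, ρ j s • x j‖ ∂Q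
    set b := ∫ s, ‖y - x n + ∑ j ∈ Finset.range n, ρ j s • x j‖ ∂Q
    set d := ∑ j ∈ Finset.range n, ‖x j‖ ^ 2
    have h_sq : c ^ 2 * (a - b) ^ 2 ≤ c ^ 2 * (2 * ‖x n‖) ^ 2 := by
      gcongr ?_ * ?_
      exact sq_le_sq.mpr (h_diff.trans (le_abs_self _))
    calc _ ≤ (Real.exp (c * a + c ^ 2 / 2 * d) + Real.exp (c * b + c ^ 2 / 2 * d)) / 2 := by
          linarith
      _ ≤ _ := exp_add_exp_div_two_le _ _
      _ ≤ Real.exp (c * ((a + b) / 2) + c ^ 2 / 2 * (d + ‖x n‖ ^ 2)) := by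
          rw [Real.exp_le_exp]
          linarith

end IsRademacherFamily

/-! ### Type constants -/

theorem eLpNorm_le_of_integral_exp_norm_div_le {Ω V : Type*} [MeasurableSpace Ω] {P : Measure Ω}
    [NormedAddCommGroup V] {f : Ω → V} {q b c : ℝ} (hq : 1 ≤ q) (hb : 0 < b) (hc : 0 ≤ c)
    (hf : Integrable (fun ω => Real.exp (‖f ω‖ / b)) P)
    (h_exp : ∫ ω, Real.exp (‖f ω‖ / b) ∂P ≤ Real.exp c) :
    eLpNorm f (ENNReal.ofReal q) P ≤ ENNReal.ofReal (q * Real.exp c * b) := by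
  have hq₀ : 0 < q := by linarith
  have h_pow (ω : Ω) : ‖f ω‖ ^ q ≤ (q * b) ^ q * Real.exp (‖f ω‖ / b) := by
    calc ‖f ω‖ ^ q = b ^ q * (‖f ω‖ / b) ^ q := by
          rw [← Real.mul_rpow hb.le (by positivity), mul_div_cancel₀ _ hb.ne']
      _ ≤ b ^ q * (q ^ q * Real.exp (‖f ω‖ / b)) := by
          gcongr
          exact rpow_le_rpow_self_mul_exp hq₀ (by positivity)
      _ = (q * b) ^ q * Real.exp (‖f ω‖ / b) := by
          rw [Real.mul_rpow hq₀.le hb.le]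
          ring
  have h_const : (q * b) ^ q * Real.exp c ≤ (q * Real.exp c * b) ^ q := by
    calc (q * b) ^ q * Real.exp c ≤ (q * b) ^ q * Real.exp c ^ q := by
          gcongr
          exact Real.self_le_rpow_of_one_le (Real.one_le_exp hc) hq
      _ = (q * Real.exp c * b) ^ q := by
          rw [← Real.mul_rpow (by positivity) (by positivity), mul_right_comm]
  rw [eLpNorm_eq_lintegral_rpow_enorm_toReal (by simpa using hq₀) ENNReal.ofReal_ne_top,
    ENNReal.toReal_ofReal hq₀.le, one_div, ENNReal.rpow_inv_le_iff hq₀]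
  calc ∫⁻ ω, ‖f ω‖ₑ ^ q ∂P
      = ∫⁻ ω, ENNReal.ofReal (‖f ω‖ ^ q) ∂P := by
        simp only [← ENNReal.ofReal_rpow_of_nonneg (norm_nonneg _) hq₀.le, ofReal_norm]
    _ ≤ ∫⁻ ω, ENNReal.ofReal ((q * b) ^ q * Real.exp (‖f ω‖ / b)) ∂P :=
        lintegral_mono fun ω => ENNReal.ofReal_le_ofReal (h_pow ω)
    _ = ENNReal.ofReal ((q * b) ^ q * ∫ ω, Real.exp (‖f ω‖ / b) ∂P) := by
        rw [← integral_const_mul, ofReal_integral_eq_lintegral_ofReal (hf.const_mul _)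
          (.of_forall fun ω => by positivity)]
    _ ≤ ENNReal.ofReal ((q * Real.exp c * b) ^ q) := by
        refine ENNReal.ofReal_le_ofReal (le_trans ?_ h_const)
        gcongr
    _ = ENNReal.ofReal (q * Real.exp c * b) ^ q :=
        (ENNReal.ofReal_rpow_of_nonneg (by positivity) hq₀.le).symm

namespace HasTypeConstant

variable {V : Type*} [NormedAddCommGroup V] [NormedSpace ℝ V] {r τ : ℝ}

theorem one_le [Nontrivial V] (hτ : HasTypeConstant V r τ) (hr : 0 < r) : 1 ≤ τ := by
  obtain ⟨S, _, Q, _, ρ, hρ⟩ := exists_isRademacherFamily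
  obtain ⟨x, hx⟩ := exists_ne (0 : V)
  have hx₀ : 0 < ‖x‖ := norm_pos_iff.mpr hx
  have h_norm : eLpNorm (fun s => ∑ j ∈ Finset.range 1, ρ j s • x) (ENNReal.ofReal r) Q =
      ENNReal.ofReal ‖x‖ := by
    rw [eLpNorm_congr_norm_ae (g := fun _ => x) (.of_forall fun s => by
      simp [norm_smul, hρ.abs_eq_one]), eLpNorm_const _ (by simpa using hr)
      (IsProbabilityMeasure.ne_zero Q)]
    simp
  have h_le := hτ S Q ρ hρ 1 fun _ => x
  rw [h_norm, Finset.sum_range_one, ← Real.rpow_mul hx₀.le, mul_one_div_cancel hr.ne',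
    Real.rpow_one] at h_le
  by_contra! h_lt
  exact h_le.not_gt ((ENNReal.ofReal_lt_ofReal_iff hx₀).mpr (mul_lt_of_lt_one_left hx₀ h_lt))

variable {S : Type} [MeasurableSpace S] {Q : Measure S} [IsProbabilityMeasure Q] {ρ : ℕ → S → ℝ}

theorem integral_norm_sum_le (hτ : HasTypeConstant V r τ) (hτ₀ : 0 ≤ τ) (hr : 1 ≤ r)
    (hρ : IsRademacherFamily Q ρ) (n : ℕ) (x : ℕ → V) :
    ∫ s, ‖∑ j ∈ Finset.range n, ρ j s • x j‖ ∂Q ≤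
      τ * (∑ j ∈ Finset.range n, ‖x j‖ ^ r) ^ (1 / r) := by
  have h_meas : AEStronglyMeasurable (fun s => ∑ j ∈ Finset.range n, ρ j s • x j) Q :=
    Finset.aestronglyMeasurable_fun_sum _ fun j _ =>
      (hρ.measurable j).aestronglyMeasurable.smul_const (x j)
  rw [← ENNReal.ofReal_le_ofReal_iff (by positivity), integral_norm_eq_lintegral_enorm h_meas,
    ← eLpNorm_one_eq_lintegral_enorm]
  exact ENNReal.ofReal_toReal_le.trans
    ((eLpNorm_le_eLpNorm_of_exponent_le (by simpa using hr) h_meas).trans (hτ S Q ρ hρ n x))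

theorem integral_exp_norm_sum_div_le [Nontrivial V] (hτ : HasTypeConstant V r τ) (hr : 1 ≤ r)
    (hr₂ : r ≤ 2) (hρ : IsRademacherFamily Q ρ) (n : ℕ) (x : ℕ → V)
    (hx : 0 < ∑ j ∈ Finset.range n, ‖x j‖ ^ r) :
    ∫ s, Real.exp (‖∑ j ∈ Finset.range n, ρ j s • x j‖ /
        (τ * (∑ j ∈ Finset.range n, ‖x j‖ ^ r) ^ (1 / r))) ∂Q ≤ Real.exp (3 / 2) := by
  have hr₀ : 0 < r := by linarith
  have hτ₁ : 1 ≤ τ := hτ.one_le hr₀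
  have h_mean := hτ.integral_norm_sum_le (by linarith) hr hρ n x
  set σ := (∑ j ∈ Finset.range n, ‖x j‖ ^ r) ^ (1 / r) with hσ
  have hσ₀ : 0 < σ := by positivity
  have h_sq : ∑ j ∈ Finset.range n, ‖x j‖ ^ 2 ≤ (τ * σ) ^ 2 := by
    calc ∑ j ∈ Finset.range n, ‖x j‖ ^ 2 = ∑ j ∈ Finset.range n, (‖x j‖ ^ r) ^ (2 / r) := by
          refine Finset.sum_congr rfl fun j _ => ?_
          rw [← Real.rpow_mul (norm_nonneg _), mul_div_cancel₀ _ hr₀.ne', Real.rpow_two]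
      _ ≤ (∑ j ∈ Finset.range n, ‖x j‖ ^ r) ^ (2 / r) :=
          sum_rpow_le_rpow_sum _ (fun j => by positivity) ((one_le_div hr₀).mpr hr₂)
      _ = σ ^ 2 := by
          rw [hσ, ← Real.rpow_two, ← Real.rpow_mul hx.le, one_div_mul_eq_div]
      _ ≤ (τ * σ) ^ 2 := by
          gcongr
          exact le_mul_of_one_le_left hσ₀.le hτ₁
  have h_exp := hρ.integral_exp_norm_le (τ * σ)⁻¹ n x 0
  simp only [zero_add] at h_exp
  simp only [div_eq_inv_mul]
  refine h_exp.trans (Real.exp_le_exp.mpr ?_)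
  have : 0 < τ * σ := by positivity
  calc _ ≤ (τ * σ)⁻¹ * (τ * σ) + (τ * σ)⁻¹ ^ 2 / 2 * (τ * σ) ^ 2 := by gcongr
    _ = 2⁻¹ * 3 := by
        field_simp
        norm_num

theorem eLpNorm_sum_le [Nontrivial V] (hτ : HasTypeConstant V r τ) (hr : 1 ≤ r) (hr₂ : r ≤ 2)
    {q : ℝ} (hq : 1 ≤ q) (hρ : IsRademacherFamily Q ρ) (n : ℕ) (x : ℕ → V) :
    eLpNorm (fun s => ∑ j ∈ Finset.range n, ρ j s • x j) (ENNReal.ofReal q) Q ≤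
      ENNReal.ofReal
        (q * Real.exp (3 / 2) * (τ * (∑ j ∈ Finset.range n, ‖x j‖ ^ r) ^ (1 / r))) := by
  have hr₀ : 0 < r := by linarith
  have : 0 < q := by linarith
  have hτ₁ : 1 ≤ τ := hτ.one_le hr₀
  have hσ_nonneg : 0 ≤ ∑ j ∈ Finset.range n, ‖x j‖ ^ r := by positivity
  rcases hσ_nonneg.eq_or_lt with hσ | hσ
  · have hx : ∀ j ∈ Finset.range n, x j = 0 := fun j hj => by
      have := (Finset.sum_eq_zero_iff_of_nonneg fun j _ => by positivity).mp hσ.symm j hj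
      rwa [Real.rpow_eq_zero (norm_nonneg _) hr₀.ne', norm_eq_zero] at this
    have h_zero (s : S) : ∑ j ∈ Finset.range n, ρ j s • x j = 0 :=
      Finset.sum_eq_zero fun j hj => by rw [hx j hj, smul_zero]
    simp [h_zero]
  have h_exp := hτ.integral_exp_norm_sum_div_le hr hr₂ hρ n x hσ
  set b := τ * (∑ j ∈ Finset.range n, ‖x j‖ ^ r) ^ (1 / r)
  have : 0 < b := by positivity
  have h_int := hρ.integrable_comp_sum (F := fun v => Real.exp (‖v‖ / b)) (by fun_prop) n x 0
  simp only [zero_add] at h_int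
  exact eLpNorm_le_of_integral_exp_norm_div_le hq (by positivity) (by norm_num) h_int h_exp

end HasTypeConstant

/-! ### Sums of independent random variables -/

theorem eLpNorm_ofReal_rpow_eq_lintegral {Ω F : Type*} [MeasurableSpace Ω] {P : Measure Ω}
    [ENorm F] {f : Ω → F} {q : ℝ} (hq : 0 < q) :
    eLpNorm f (ENNReal.ofReal q) P ^ q = ∫⁻ ω, ‖f ω‖ₑ ^ q ∂P := by
  have h := eLpNorm_nnreal_pow_eq_lintegral (f := f) (μ := P) (Real.toNNReal_pos.mpr hq).ne'
  rwa [Real.coe_toNNReal _ hq.le] at h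

theorem eLpNorm_rpow_sum_enorm_rpow_le {Ω V ι : Type*} [MeasurableSpace Ω] {P : Measure Ω}
    [NormedAddCommGroup V] {Y : ι → Ω → V} (t : Finset ι)
    (hY : ∀ j ∈ t, AEStronglyMeasurable (Y j) P) {q r : ℝ} (hr : 0 < r) (hrq : r ≤ q) :
    eLpNorm (fun ω => (∑ j ∈ t, ‖Y j ω‖ₑ ^ r) ^ (1 / r)) (ENNReal.ofReal q) P ≤
      (∑ j ∈ t, eLpNorm (Y j) (ENNReal.ofReal q) P ^ r) ^ (1 / r) := by
  have h_exponent : ENNReal.ofReal q = ENNReal.ofReal (q / r) * ENNReal.ofReal r := by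
    rw [← ENNReal.ofReal_mul (by have := hr.trans_le hrq; positivity), div_mul_cancel₀ _ hr.ne']
  rw [one_div, ENNReal.le_rpow_inv_iff hr]
  simp only [h_exponent, ← eLpNorm_enorm_rpow _ hr, enorm_eq_self, ← ENNReal.rpow_mul,
    inv_mul_cancel₀ hr.ne', ENNReal.rpow_one]
  rw [← Finset.sum_fn]
  exact eLpNorm_sum_le (fun j hj => ((hY j hj).enorm.pow_const r).aestronglyMeasurable)
    (by simpa using (one_le_div hr).mpr hrq)

section IndependentSums

variable {Ω V : Type*} [MeasurableSpace Ω] {P : Measure Ω} [IsProbabilityMeasure P]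
  [NormedAddCommGroup V] [NormedSpace ℝ V] [CompleteSpace V] [MeasurableSpace V] [BorelSpace V]
  [SecondCountableTopology V]

-- `U` is a version of the conditional expectation of `U + W` given `U`.
theorem eLpNorm_le_eLpNorm_add_of_indepFun {U W : Ω → V} (hUW : IndepFun U W P)
    (hU : Integrable U P) (hW : Integrable W P) (hW₀ : ∫ ω, W ω ∂P = 0) {p : ENNReal}
    (hp : 1 ≤ p) : eLpNorm U p P ≤ eLpNorm (U + W) p P := by
  wlog h_meas : Measurable U ∧ Measurable W generalizing U W
  · have hU_eq := hU.aemeasurable.ae_eq_mk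
    have hW_eq := hW.aemeasurable.ae_eq_mk
    rw [eLpNorm_congr_ae hU_eq, eLpNorm_congr_ae (hU_eq.add hW_eq)]
    exact this (hUW.congr hU_eq hW_eq) (hU.congr hU_eq) (hW.congr hW_eq)
      ((integral_congr_ae hW_eq).symm.trans hW₀)
      ⟨hU.aemeasurable.measurable_mk, hW.aemeasurable.measurable_mk⟩
  have h_condExp_W : P[W | MeasurableSpace.comap U inferInstance] =ᵐ[P] 0 := by
    filter_upwards [condExp_indep_eq h_meas.2.comap_le h_meas.1.comap_le
      (comap_measurable W).stronglyMeasurable hUW.symm] with ω hω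
    rw [hω, hW₀, Pi.zero_apply]
  have h_condExp : P[U + W | MeasurableSpace.comap U inferInstance] =ᵐ[P] U := by
    refine (condExp_add hU hW _).trans ?_
    rw [condExp_of_stronglyMeasurable h_meas.1.comap_le
      (comap_measurable U).stronglyMeasurable hU]
    filter_upwards [h_condExp_W] with ω hω
    simp [hω]
  rw [← eLpNorm_congr_ae h_condExp]
  exact eLpNorm_condExp_le_eLpNorm _ hp

theorem eLpNorm_add_le_two_mul_eLpNorm_sub_of_indepFun {U W : Ω → V} (hUW : IndepFun U W P)
    (hU : Integrable U P) (hW : Integrable W P) (hU₀ : ∫ ω, U ω ∂P = 0) (hW₀ : ∫ ω, W ω ∂P = 0)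
    {p : ENNReal} (hp : 1 ≤ p) : eLpNorm (U + W) p P ≤ 2 * eLpNorm (U - W) p P := by
  have hU_le : eLpNorm U p P ≤ eLpNorm (U - W) p P := by
    rw [sub_eq_add_neg]
    exact eLpNorm_le_eLpNorm_add_of_indepFun hUW.neg_right hU hW.neg
      (by rw [integral_neg', hW₀, neg_zero]) hp
  have hW_le : eLpNorm W p P ≤ eLpNorm (U - W) p P := by
    rw [eLpNorm_sub_comm, sub_eq_add_neg]
    exact eLpNorm_le_eLpNorm_add_of_indepFun hUW.symm.neg_right hW hU.neg
      (by rw [integral_neg', hU₀, neg_zero]) hp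
  calc eLpNorm (U + W) p P ≤ eLpNorm U p P + eLpNorm W p P :=
        eLpNorm_add_le hU.aestronglyMeasurable hW.aestronglyMeasurable hp
    _ ≤ 2 * eLpNorm (U - W) p P := by
        rw [two_mul]
        gcongr

theorem eLpNorm_sum_le_two_mul_eLpNorm_sum_smul_of_iIndepFun {ι : Type*} {Y : ι → Ω → V}
    (hY : iIndepFun Y P) (hY_int : ∀ j, Integrable (Y j) P) (hY₀ : ∀ j, ∫ ω, Y j ω ∂P = 0)
    {p : ENNReal} (hp : 1 ≤ p) (t : Finset ι) {s : ι → ℝ} (hs : ∀ j, s j = 1 ∨ s j = -1) :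
    eLpNorm (fun ω => ∑ j ∈ t, Y j ω) p P ≤ 2 * eLpNorm (fun ω => ∑ j ∈ t, s j • Y j ω) p P := by
  classical
  let T (u : Finset ι) (ω : Ω) : V := ∑ j ∈ u, Y j ω
  have hT_int (u : Finset ι) : Integrable (T u) P := integrable_finsetSum _ fun j _ => hY_int j
  have hT₀ (u : Finset ι) : ∫ ω, T u ω ∂P = 0 := by
    rw [integral_finsetSum _ fun j _ => hY_int j]
    exact Finset.sum_eq_zero fun j _ => hY₀ j
  have hT_indep {u w : Finset ι} (h : Disjoint u w) : IndepFun (T u) (T w) P := by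
    have hT (u : Finset ι) : T u = (fun z : u → V => ∑ j, z j) ∘ fun ω j => Y j ω :=
      funext fun ω => (Finset.sum_coe_sort u fun j => Y j ω).symm
    rw [hT u, hT w]
    exact (hY.indepFun_finset₀ u w h fun j => (hY_int j).aemeasurable).comp
      (Continuous.measurable (by fun_prop)) (Continuous.measurable (by fun_prop))
  let tpos := t.filter fun j => s j = 1
  let tneg := t.filter fun j => ¬ s j = 1
  have h_sum : (fun ω => ∑ j ∈ t, Y j ω) = T tpos + T tneg :=
    funext fun ω => (Finset.sum_filter_add_sum_filter_not t (fun j => s j = 1) _).symm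
  have h_sum_smul : (fun ω => ∑ j ∈ t, s j • Y j ω) = T tpos - T tneg := by
    funext ω
    rw [← Finset.sum_filter_add_sum_filter_not t (fun j => s j = 1), Pi.sub_apply, sub_eq_add_neg,
      ← Finset.sum_neg_distrib]
    congr 1 <;> refine Finset.sum_congr rfl fun j hj => ?_
    · rw [(Finset.mem_filter.mp hj).2, one_smul]
    · rw [(hs j).resolve_left (Finset.mem_filter.mp hj).2, neg_one_smul]
  rw [h_sum, h_sum_smul]
  exact eLpNorm_add_le_two_mul_eLpNorm_sub_of_indepFun
    (hT_indep (Finset.disjoint_filter_filter_not _ _ _)) (hT_int _) (hT_int _) (hT₀ _) (hT₀ _) hp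

theorem eLpNorm_sum_le_two_mul_eLpNorm_eLpNorm_sum_smul_of_iIndepFun {Y : ℕ → Ω → V}
    (hY : iIndepFun Y P) (hY_int : ∀ j, Integrable (Y j) P) (hY₀ : ∀ j, ∫ ω, Y j ω ∂P = 0)
    {S : Type*} [MeasurableSpace S] {Q : Measure S} [IsProbabilityMeasure Q] {ρ : ℕ → S → ℝ}
    (hρ : IsRademacherFamily Q ρ) {q : ℝ} (hq : 1 ≤ q) (t : Finset ℕ) :
    eLpNorm (fun ω => ∑ j ∈ t, Y j ω) (ENNReal.ofReal q) P ≤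
      2 * eLpNorm (fun ω => eLpNorm (fun s => ∑ j ∈ t, ρ j s • Y j ω) (ENNReal.ofReal q) Q)
        (ENNReal.ofReal q) P := by
  have hq₀ : 0 < q := by linarith
  have h_meas : AEMeasurable (fun z : S × Ω => ‖∑ j ∈ t, ρ j z.1 • Y j z.2‖ₑ ^ q) (Q.prod P) := by
    refine (Finset.aemeasurable_fun_sum _ fun j _ => ?_).enorm.pow_const _
    exact ((hρ.measurable j).comp measurable_fst).aemeasurable.smul
      (hY_int j).aemeasurable.comp_snd
  rw [← ENNReal.rpow_le_rpow_iff hq₀, ENNReal.mul_rpow_of_nonneg _ _ hq₀.le,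
    eLpNorm_ofReal_rpow_eq_lintegral hq₀ (f := fun ω => eLpNorm _ _ _)]
  calc eLpNorm (fun ω => ∑ j ∈ t, Y j ω) (ENNReal.ofReal q) P ^ q
      = ∫⁻ _ : S, eLpNorm (fun ω => ∑ j ∈ t, Y j ω) (ENNReal.ofReal q) P ^ q ∂Q := by simp
    _ ≤ ∫⁻ s, 2 ^ q * eLpNorm (fun ω => ∑ j ∈ t, ρ j s • Y j ω) (ENNReal.ofReal q) P ^ q ∂Q := by
        refine lintegral_mono fun s => ?_
        rw [← ENNReal.mul_rpow_of_nonneg _ _ hq₀.le]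
        exact ENNReal.rpow_le_rpow (eLpNorm_sum_le_two_mul_eLpNorm_sum_smul_of_iIndepFun hY
          hY_int hY₀ (by simpa using hq) t fun j => hρ.values j s) hq₀.le
    _ = 2 ^ q * ∫⁻ ω, ∫⁻ s, ‖∑ j ∈ t, ρ j s • Y j ω‖ₑ ^ q ∂Q ∂P := by
        simp only [eLpNorm_ofReal_rpow_eq_lintegral hq₀]
        rw [lintegral_const_mul' _ _ (by simp), lintegral_lintegral_swap h_meas]
    _ = 2 ^ q * ∫⁻ ω, ‖eLpNorm (fun s => ∑ j ∈ t, ρ j s • Y j ω) (ENNReal.ofReal q) Q‖ₑ ^ q ∂P := by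
        simp only [enorm_eq_self, eLpNorm_ofReal_rpow_eq_lintegral hq₀]

theorem HasTypeConstant.eLpNorm_sum_le_of_iIndepFun [Nontrivial V] {r τ : ℝ}
    (hτ : HasTypeConstant V r τ) (hr : 1 ≤ r) (hr₂ : r ≤ 2) {q : ℝ} (hrq : r ≤ q)
    {Y : ℕ → Ω → V} (hY : iIndepFun Y P) (hY_int : ∀ j, Integrable (Y j) P)
    (hY₀ : ∀ j, ∫ ω, Y j ω ∂P = 0) (n : ℕ) :
    eLpNorm (fun ω => ∑ j ∈ Finset.range n, Y j ω) (ENNReal.ofReal q) P ≤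
      ENNReal.ofReal (2 * q * Real.exp (3 / 2) * τ) *
        (∑ j ∈ Finset.range n, eLpNorm (Y j) (ENNReal.ofReal q) P ^ r) ^ (1 / r) := by
  have hr₀ : 0 < r := by linarith
  have hq : 1 ≤ q := hr.trans hrq
  have hτ₀ : 0 ≤ τ := zero_le_one.trans (hτ.one_le hr₀)
  obtain ⟨S, _, Q, _, ρ, hρ⟩ := exists_isRademacherFamily
  have h_pointwise (ω : Ω) :
      eLpNorm (fun s => ∑ j ∈ Finset.range n, ρ j s • Y j ω) (ENNReal.ofReal q) Q ≤
        ENNReal.ofReal (q * Real.exp (3 / 2) * τ) *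
          (∑ j ∈ Finset.range n, ‖Y j ω‖ₑ ^ r) ^ (1 / r) := by
    refine (hτ.eLpNorm_sum_le hr hr₂ hq hρ n fun j => Y j ω).trans_eq ?_
    rw [← mul_assoc, ENNReal.ofReal_mul (by positivity),
      ← ENNReal.ofReal_rpow_of_nonneg (by positivity) (by positivity),
      ENNReal.ofReal_sum_of_nonneg fun j _ => by positivity]
    simp only [← ENNReal.ofReal_rpow_of_nonneg (norm_nonneg _) hr₀.le, ofReal_norm]
  calc eLpNorm (fun ω => ∑ j ∈ Finset.range n, Y j ω) (ENNReal.ofReal q) P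
      ≤ 2 * eLpNorm (fun ω => eLpNorm (fun s => ∑ j ∈ Finset.range n, ρ j s • Y j ω)
          (ENNReal.ofReal q) Q) (ENNReal.ofReal q) P :=
        eLpNorm_sum_le_two_mul_eLpNorm_eLpNorm_sum_smul_of_iIndepFun hY hY_int hY₀ hρ hq _
    _ ≤ 2 * (ENNReal.ofReal (q * Real.exp (3 / 2) * τ) * eLpNorm (fun ω =>
          (∑ j ∈ Finset.range n, ‖Y j ω‖ₑ ^ r) ^ (1 / r)) (ENNReal.ofReal q) P) := by
        gcongr
        exact eLpNorm_le_mul_eLpNorm_of_ae_le_mul' (c := Real.toNNReal _) (.of_forall h_pointwise) _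
    _ ≤ 2 * (ENNReal.ofReal (q * Real.exp (3 / 2) * τ) *
          (∑ j ∈ Finset.range n, eLpNorm (Y j) (ENNReal.ofReal q) P ^ r) ^ (1 / r)) := by
        gcongr
        exact eLpNorm_rpow_sum_enorm_rpow_le _ (fun j _ => (hY_int j).aestronglyMeasurable) hr₀ hrq
    _ = ENNReal.ofReal (2 * q * Real.exp (3 / 2) * τ) *
        (∑ j ∈ Finset.range n, eLpNorm (Y j) (ENNReal.ofReal q) P ^ r) ^ (1 / r) := by
        rw [← mul_assoc, ← ENNReal.ofReal_ofNat, ← ENNReal.ofReal_mul zero_le_two]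
        simp only [mul_assoc]

theorem HasTypeConstant.eLpNorm_sum_sub_integral_le_of_identDistrib [Nontrivial V] {r τ : ℝ}
    (hτ : HasTypeConstant V r τ) (hr : 1 ≤ r) (hr₂ : r ≤ 2) {q : ℝ} (hrq : r ≤ q)
    {Y : ℕ → Ω → V} (hY : iIndepFun Y P) {Z : Ω → V} (hZ : Integrable Z P)
    (hYZ : ∀ j, IdentDistrib (Y j) Z P P) (n : ℕ) :
    eLpNorm (fun ω => ∑ j ∈ Finset.range n, (Y j ω - ∫ ω', Z ω' ∂P)) (ENNReal.ofReal q) P ≤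
      ENNReal.ofReal (2 * q * Real.exp (3 / 2) * τ) *
        ((n : ENNReal) ^ (1 / r) *
          eLpNorm (fun ω => Z ω - ∫ ω', Z ω' ∂P) (ENNReal.ofReal q) P) := by
  have hr₀ : 0 < r := by linarith
  set m := ∫ ω, Z ω ∂P
  have h_meas : Measurable fun v : V => v - m := measurable_sub_const m
  have hY_int (j : ℕ) : Integrable (Y j) P := (hYZ j).integrable_iff.mpr hZ
  have h_centred (j : ℕ) : ∫ ω, (Y j ω - m) ∂P = 0 := by
    rw [integral_sub (hY_int j) (integrable_const m), (hYZ j).integral_eq, integral_const,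
      probReal_univ, one_smul, sub_self]
  have h_norm (j : ℕ) : eLpNorm (fun ω => Y j ω - m) (ENNReal.ofReal q) P =
      eLpNorm (fun ω => Z ω - m) (ENNReal.ofReal q) P :=
    ((hYZ j).comp h_meas).eLpNorm_eq _
  refine (hτ.eLpNorm_sum_le_of_iIndepFun hr hr₂ hrq (hY.comp (fun _ v => v - m) fun _ => h_meas)
    (fun j => (hY_int j).sub (integrable_const m)) h_centred n).trans_eq ?_
  simp only [Function.comp_def, h_norm, Finset.sum_const, Finset.card_range, nsmul_eq_mul]
  rw [ENNReal.mul_rpow_of_nonneg _ _ (by positivity), ← ENNReal.rpow_mul,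
    mul_one_div_cancel hr₀.ne', ENNReal.rpow_one]

end IndependentSums

/-! ### The single-level estimator -/

theorem slmcError_le_enorm_add {Ω E : Type*} [MeasurableSpace Ω] {P : Measure Ω}
    [IsProbabilityMeasure P] [NormedAddCommGroup E] [NormedSpace ℝ E] {q : ℝ} (hq : 1 ≤ q)
    (X : Ω → E) {Y : ℕ → Ω → E} (hY : ∀ j, AEStronglyMeasurable (Y j) P) (m : E) {M : ℕ}
    (hM : M ≠ 0) :
    slmcError P q X Y M ≤ ‖(∫ ω, X ω ∂P) - m‖ₑ +
      (M : ENNReal)⁻¹ *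
        eLpNorm (fun ω => ∑ j ∈ Finset.range M, (Y j ω - m)) (ENNReal.ofReal q) P := by
  have hM₀ : (M : ℝ) ≠ 0 := Nat.cast_ne_zero.mpr hM
  have hp : 1 ≤ ENNReal.ofReal q := by simpa using hq
  have h_split : (fun ω => (∫ ω', X ω' ∂P) - (1 / (M : ℝ)) • ∑ j ∈ Finset.range M, Y j ω) =
      (fun _ => (∫ ω', X ω' ∂P) - m) -
        (M : ℝ)⁻¹ • fun ω => ∑ j ∈ Finset.range M, (Y j ω - m) := by
    funext ω
    simp only [Pi.sub_apply, Pi.smul_apply, Finset.sum_sub_distrib, Finset.sum_const,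
      Finset.card_range, smul_sub, ← Nat.cast_smul_eq_nsmul ℝ M m, smul_smul, inv_mul_cancel₀ hM₀,
      one_smul, one_div]
    abel
  have h_meas : AEStronglyMeasurable (fun ω => ∑ j ∈ Finset.range M, (Y j ω - m)) P :=
    Finset.aestronglyMeasurable_fun_sum _ fun j _ => (hY j).sub aestronglyMeasurable_const
  rw [slmcError, h_split]
  refine (eLpNorm_sub_le aestronglyMeasurable_const (h_meas.const_smul _) hp).trans_eq ?_
  rw [eLpNorm_const _ (by positivity) (IsProbabilityMeasure.ne_zero P), eLpNorm_const_smul,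
    enorm_inv hM₀]
  simp

section SingleLevel

variable {Ω E : Type*} [MeasurableSpace Ω] {P : Measure Ω} [IsProbabilityMeasure P]
  [NormedAddCommGroup E] [NormedSpace ℝ E] [CompleteSpace E] [MeasurableSpace E] [BorelSpace E]
  {V : Submodule ℝ E} [FiniteDimensional ℝ V] [Nontrivial V] {q r : ℝ} {Z : Ω → V} {Y : ℕ → Ω → V}

theorem HasTypeConstant.slmcError_le {τ b : ℝ} (hτ : HasTypeConstant V r τ) (hr : 1 ≤ r)
    (hr₂ : r ≤ 2) (hrq : r ≤ q) (hb : 0 ≤ b) (hZ : Integrable Z P) (hY : iIndepFun Y P)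
    (hYZ : ∀ j, IdentDistrib (Y j) Z P P)
    (hZb : eLpNorm (fun ω => (Z ω : E) - ∫ ω', (Z ω' : E) ∂P) (ENNReal.ofReal q) P ≤
      ENNReal.ofReal b) (X : Ω → E) {M : ℕ} (hM : M ≠ 0) :
    slmcError P q X (fun j ω => (Y j ω : E)) M ≤
      ENNReal.ofReal (‖(∫ ω, X ω ∂P) - ∫ ω, (Z ω : E) ∂P‖ +
        (M : ℝ) ^ (1 / r - 1) * (2 * q * Real.exp (3 / 2) * τ * b)) := by
  have : ProperSpace V := FiniteDimensional.proper_real V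
  have hτ₀ : 0 ≤ τ := zero_le_one.trans (hτ.one_le (by linarith))
  have hq : 0 ≤ q := by linarith
  have hM₀ : (0 : ℝ) < M := by positivity
  have hm : ∫ ω, (Z ω : E) ∂P = (∫ ω, Z ω ∂P : V) := V.subtypeL.integral_comp_comm hZ
  rw [hm] at hZb ⊢
  have hY_meas (j : ℕ) : AEStronglyMeasurable (fun ω => (Y j ω : E)) P :=
    V.subtypeL.continuous.comp_aestronglyMeasurable
      ((hYZ j).integrable_iff.mpr hZ).aestronglyMeasurable
  have h_coe : eLpNorm (fun ω => ∑ j ∈ Finset.range M, ((Y j ω : E) - (∫ ω', Z ω' ∂P : V)))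
      (ENNReal.ofReal q) P = eLpNorm (fun ω => ∑ j ∈ Finset.range M, (Y j ω - ∫ ω', Z ω' ∂P))
        (ENNReal.ofReal q) P :=
    eLpNorm_congr_norm_ae (.of_forall fun ω => by
      rw [← Submodule.norm_coe]
      push_cast
      rfl)
  rw [ENNReal.ofReal_add (norm_nonneg _) (by positivity), ofReal_norm]
  refine (slmcError_le_enorm_add (by linarith) X hY_meas (∫ ω, Z ω ∂P : V) hM).trans ?_
  gcongr
  rw [h_coe]
  calc _ ≤ (M : ENNReal)⁻¹ * (ENNReal.ofReal (2 * q * Real.exp (3 / 2) * τ) *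
          ((M : ENNReal) ^ (1 / r) * ENNReal.ofReal b)) := by
        gcongr
        refine (hτ.eLpNorm_sum_sub_integral_le_of_identDistrib hr hr₂ hrq hY hZ hYZ M).trans ?_
        gcongr
        exact hZb
    _ = ENNReal.ofReal ((M : ℝ) ^ (1 / r - 1) * (2 * q * Real.exp (3 / 2) * τ * b)) := by
        rw [← ENNReal.ofReal_natCast, ← ENNReal.ofReal_inv_of_pos hM₀,
          ENNReal.ofReal_rpow_of_pos hM₀, ← ENNReal.ofReal_mul (by positivity),
          ← ENNReal.ofReal_mul (by positivity), ← ENNReal.ofReal_mul (by positivity),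
          Real.rpow_sub_one hM₀.ne']
        congr 1
        ring

theorem HasTypeConstant.exists_slmcError_lt {G b ε : ℝ} (hr : 1 < r)
    (hτ : HasTypeConstant V r (G ^ r.conjExponent⁻¹))
    (hr₂ : r ≤ 2) (hrq : r ≤ q) (hG : 0 < G) (hb : 0 < b) (hε : 0 < ε) (hZ : Integrable Z P)
    (hY : iIndepFun Y P) (hYZ : ∀ j, IdentDistrib (Y j) Z P P)
    (hZb : eLpNorm (fun ω => (Z ω : E) - ∫ ω', (Z ω' : E) ∂P) (ENNReal.ofReal q) P ≤
      ENNReal.ofReal b) {X : Ω → E} (hX : ‖(∫ ω, X ω ∂P) - ∫ ω, (Z ω : E) ∂P‖ ≤ ε / 3) :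
    ∃ M : ℕ, 1 ≤ M ∧ slmcError P q X (fun j ω => (Y j ω : E)) M < ENNReal.ofReal ε ∧
      (M : ℝ) ≤ (6 * q * Real.exp (3 / 2) * b / ε) ^ r.conjExponent * G + 1 := by
  have hconj := Real.HolderConjugate.conjExponent hr
  have hs : 0 < r.conjExponent := hconj.symm.pos
  have hq : 0 < q := by linarith
  have h_exponent : 1 / r - 1 = -r.conjExponent⁻¹ := by
    rw [one_div]
    linarith [hconj.inv_add_inv_eq_one]
  obtain ⟨M, hM, h_fluctuation, hM_le⟩ := exists_natCast_rpow_mul_le hs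
    (κ := 2 * q * Real.exp (3 / 2) * G ^ r.conjExponent⁻¹ * b) (by positivity)
    (show 0 < ε / 3 by positivity)
  refine ⟨M, hM, ?_, hM_le.trans_eq ?_⟩
  · refine (hτ.slmcError_le hr.le hr₂ hrq hb.le hZ hY hYZ hZb X (by omega)).trans_lt ?_
    rw [ENNReal.ofReal_lt_ofReal_iff hε, h_exponent]
    linarith
  · congr 1
    rw [show 2 * q * Real.exp (3 / 2) * G ^ r.conjExponent⁻¹ * b / (ε / 3) =
      6 * q * Real.exp (3 / 2) * b / ε * G ^ r.conjExponent⁻¹ by field_simp; norm_num,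
      Real.mul_rpow (by positivity) (by positivity), Real.rpow_inv_rpow hG.le hs.ne']

end SingleLevel

theorem hasTypeConstant_of_typeConstant_le {V : Type*} [NormedAddCommGroup V] [NormedSpace ℝ V]
    {r t : ℝ} (h : typeConstant V r ≤ ENNReal.ofReal t) : HasTypeConstant V r t := by
  intro S _ Q _ ρ hρ n x
  have hσ : 0 ≤ (∑ j ∈ Finset.range n, ‖x j‖ ^ r) ^ (1 / r) := by positivity
  have : Nonempty {τ : ℝ | 0 < τ ∧ HasTypeConstant V r τ} := by
    rw [Set.nonempty_coe_sort, Set.nonempty_iff_ne_empty]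
    intro h_empty
    simp [typeConstant, h_empty] at h
  rw [ENNReal.ofReal_mul' hσ]
  calc eLpNorm (fun s => ∑ j ∈ Finset.range n, ρ j s • x j) (ENNReal.ofReal r) Q
      ≤ typeConstant V r *
        ENNReal.ofReal ((∑ j ∈ Finset.range n, ‖x j‖ ^ r) ^ (1 / r)) := by
        rw [typeConstant, sInf_image', ENNReal.iInf_mul (by simp)]
        exact le_iInf fun τ => (τ.2.2 S Q ρ hρ n x).trans_eq (ENNReal.ofReal_mul' hσ)
    _ ≤ _ := by gcongr

theorem TypeConstantGrowth.hasTypeConstant {E : Type*} [NormedAddCommGroup E] [NormedSpace ℝ E]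
    {V : ℕ+ → Submodule ℝ E} {p a₀ a₁ Cτ : ℝ} (h : TypeConstantGrowth V p a₀ a₁ Cτ)
    (hCτ : 0 ≤ Cτ) {ℓ : ℕ+} (hV : 0 < Module.finrank ℝ (V ℓ)) {r : ℝ} (hpr : p ≤ r) (hr : 1 < r)
    (hr₂ : r ≤ 2) :
    HasTypeConstant (V ℓ) r ((Cτ * (Module.finrank ℝ (V ℓ) : ℝ) ^ (a₀ - a₁ * r.conjExponent)) ^
      r.conjExponent⁻¹) := by
  have hN : (0 : ℝ) < Module.finrank ℝ (V ℓ) := by exact_mod_cast hV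
  have hs : 0 < r.conjExponent := (Real.HolderConjugate.conjExponent hr).symm.pos
  apply hasTypeConstant_of_typeConstant_le
  have h_growth := h ℓ r ⟨⟨hpr, hr₂⟩, hr, hr₂⟩
  rw [Real.rpow_neg hN.le, ENNReal.ofReal_inv_of_pos (by positivity),
    ENNReal.inv_mul_le_iff (by simpa using Real.rpow_pos_of_pos hN _) ENNReal.ofReal_ne_top,
    ← ENNReal.ofReal_mul (by positivity), mul_comm] at h_growth
  rw [← ENNReal.ofReal_rpow_of_nonneg (by positivity) (by positivity)]
  exact (ENNReal.le_rpow_inv_iff hs).mpr h_growth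

theorem TypeConstantGrowth.exists_slmcError_lt {Ω E : Type*} [MeasurableSpace Ω] {P : Measure Ω}
    [IsProbabilityMeasure P] [NormedAddCommGroup E] [NormedSpace ℝ E] [CompleteSpace E]
    [MeasurableSpace E] [BorelSpace E] {V : ℕ+ → Submodule ℝ E} {p q r a₀ a₁ Cτ b ε : ℝ} {ℓ : ℕ+}
    {Z : Ω → V ℓ} {Y : ℕ → Ω → V ℓ} (h : TypeConstantGrowth V p a₀ a₁ Cτ) (hCτ : 0 < Cτ)
    (hV : 0 < Module.finrank ℝ (V ℓ)) (hpr : p ≤ r) (hr : 1 < r) (hrq : r ≤ min q 2) (hb : 0 < b)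
    (hε : 0 < ε) (hZ : Integrable Z P) (hY : iIndepFun Y P)
    (hYZ : ∀ j, IdentDistrib (Y j) Z P P)
    (hZb : eLpNorm (fun ω => (Z ω : E) - ∫ ω', (Z ω' : E) ∂P) (ENNReal.ofReal q) P ≤
      ENNReal.ofReal b) {X : Ω → E} (hX : ‖(∫ ω, X ω ∂P) - ∫ ω, (Z ω : E) ∂P‖ ≤ ε / 3) :
    ∃ M : ℕ, 1 ≤ M ∧ slmcError P q X (fun j ω => (Y j ω : E)) M < ENNReal.ofReal ε ∧
      (M : ℝ) ≤ (6 * q * Real.exp (3 / 2) * b / ε) ^ r.conjExponent *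
        (Cτ * (Module.finrank ℝ (V ℓ) : ℝ) ^ (a₀ - a₁ * r.conjExponent)) + 1 := by
  have : FiniteDimensional ℝ (V ℓ) := Module.finite_of_finrank_pos hV
  have : Nontrivial (V ℓ) := Module.nontrivial_of_finrank_pos hV
  obtain ⟨hrq, hr₂⟩ := le_min_iff.mp hrq
  exact (h.hasTypeConstant hCτ.le hV hpr hr hr₂).exists_slmcError_lt hr hr₂ hrq (by positivity)
    hb hε hZ hY hYZ hZb hX

/-! ### Choice of the level and of the type exponent -/

theorem exists_pos_le_rpow {α β x y : ℝ} (hα : 0 < α) :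
    ∃ D : ℝ, 0 < D ∧ x ≤ D ^ α ∧ (0 < β → y ≤ D ^ β) := by
  have hβ : ∀ᶠ D : ℝ in Filter.atTop, 0 < β → y ≤ D ^ β :=
    Filter.eventually_imp_distrib_left.mpr fun h =>
      (tendsto_rpow_atTop h).eventually_ge_atTop y
  exact ((Filter.eventually_gt_atTop 0).and
    (((tendsto_rpow_atTop hα).eventually_ge_atTop x).and hβ)).exists

theorem exists_pnat_pow_mem_Icc {A x : ℝ} (hA : 1 < A) (hx : 1 ≤ x) :
    ∃ L : ℕ+, A ^ (L : ℕ) ∈ Set.Icc x (A * x) := by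
  obtain ⟨n, h_le, h_lt⟩ := exists_nat_pow_near hx hA
  refine ⟨n.succPNat, h_lt.le, ?_⟩
  rw [Nat.succPNat_coe, Nat.succ_eq_add_one, pow_succ']
  gcongr

theorem exists_level_mem_Icc {N : ℕ+ → ℝ} {A c₁ c₂ D t : ℝ} (hA : 1 < A) (hc₁ : 0 < c₁)
    (hc₂ : 0 ≤ c₂) (hN : ∀ ℓ : ℕ+, c₁ * A ^ (ℓ : ℕ) ≤ N ℓ ∧ N ℓ ≤ c₂ * A ^ (ℓ : ℕ)) (hD : 0 ≤ D)
    (ht : 1 ≤ t) : ∃ L : ℕ+, N L ∈ Set.Icc (D * t) (c₂ * (A * (D / c₁ + 1)) * t) := by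
  have hx : 1 ≤ (D / c₁ + 1) * t := by
    refine one_le_mul_of_one_le_of_one_le ?_ ht
    rw [le_add_iff_nonneg_left]
    positivity
  obtain ⟨L, h_ge, h_le⟩ := exists_pnat_pow_mem_Icc hA hx
  refine ⟨L, ?_, ?_⟩
  · calc D * t ≤ c₁ * ((D / c₁ + 1) * t) := by
          rw [← mul_assoc, mul_add, mul_div_cancel₀ _ hc₁.ne']
          nlinarith
      _ ≤ c₁ * A ^ (L : ℕ) := by gcongr
      _ ≤ N L := (hN L).1
  · calc N L ≤ c₂ * A ^ (L : ℕ) := (hN L).2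
      _ ≤ c₂ * (A * ((D / c₁ + 1) * t)) := by gcongr
      _ = c₂ * (A * (D / c₁ + 1)) * t := by ring

theorem le_div_of_mul_rpow_neg_inv_le {α κ c D δ N x : ℝ} (hα : 0 < α) (hc : 0 < c) (hD : 0 < D)
    (hδ : 0 < δ) (hκ : c * κ ≤ D ^ α) (hN : D * δ ^ (-α⁻¹) ≤ N) (hx : 0 ≤ x)
    (hNx : N ^ α * x ≤ κ) : x ≤ δ / c := by
  have hNα : D ^ α / δ ≤ N ^ α := by
    calc D ^ α / δ = (D * δ ^ (-α⁻¹)) ^ α := by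
          rw [Real.mul_rpow hD.le (by positivity), ← Real.rpow_mul hδ.le, neg_mul,
            inv_mul_cancel₀ hα.ne', Real.rpow_neg_one, div_eq_mul_inv]
      _ ≤ N ^ α := by gcongr
  have h_le : D ^ α * (x * c) ≤ D ^ α * δ := by
    calc D ^ α * (x * c) = c * (D ^ α / δ * x) * δ := by field_simp
      _ ≤ c * (N ^ α * x) * δ := by gcongr
      _ ≤ D ^ α * δ := by
        gcongr
        exact (mul_le_mul_of_nonneg_left hNx hc.le).trans hκ
  exact (le_div_iff₀ hc).mpr (le_of_mul_le_mul_left h_le (by positivity))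

theorem exists_typeExponent {p q a₁ α : ℝ} (hq : 1 < q) (hp : p ≤ min q 2) :
    ∃ r, 1 < r ∧ p ≤ r ∧ r ≤ min q 2 ∧ (a₁ ≤ α → r = min q 2) ∧ (α < a₁ → 1 < p → r = p) := by
  have hq₂ : 1 < min q 2 := lt_min hq one_lt_two
  by_cases h : a₁ ≤ α ∨ p ≤ 1
  · exact ⟨min q 2, hq₂, hp, le_rfl, fun _ => rfl, fun _ _ => by grind⟩
  · exact ⟨p, by grind, le_rfl, hp, by grind, fun _ _ => rfl⟩

/-! ### Sampling cost -/

theorem rpow_le_add_mul_rpow {D D' t N : ℝ} (hD : 0 < D) (hD' : 0 ≤ D') (ht : 0 < t)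
    (hN : N ∈ Set.Icc (D * t) (D' * t)) (x : ℝ) : N ^ x ≤ (D ^ x + D' ^ x) * t ^ x := by
  have hDt : 0 < D * t := by positivity
  rw [add_mul, ← Real.mul_rpow hD.le ht.le, ← Real.mul_rpow hD' ht.le]
  have h₁ : 0 ≤ (D * t) ^ x := by positivity
  have h₂ : 0 ≤ (D' * t) ^ x := by positivity
  rcases le_total 0 x with hx | hx
  · linarith [Real.rpow_le_rpow (hDt.le.trans hN.1) hN.2 hx]
  · linarith [Real.rpow_le_rpow_of_nonpos hDt hN.1 hx]

theorem sampleCost_le {N t s α γ a₀ a₁ B G κ₁ κ₂ θ : ℝ} (hN : 0 < N) (ht : 0 < t) (hs : 0 ≤ s)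
    (hB : 0 ≤ B) (hG : 0 ≤ G) (hγ : N ^ γ ≤ κ₁ * t ^ γ)
    (ha₀ : N ^ (a₀ + γ) ≤ κ₂ * t ^ (a₀ + γ)) (ha₁ : B * N ^ (-a₁) ≤ θ * t ^ (-a₁)) :
    ((B * t ^ α) ^ s * (G * N ^ (a₀ - a₁ * s)) + 1) * N ^ γ ≤
      κ₁ * t ^ γ + G * κ₂ * θ ^ s * t ^ (α * s + γ + a₀ - a₁ * s) := by
  have hBN : 0 ≤ B * N ^ (-a₁) := by positivity
  have hκ₂ : 0 ≤ κ₂ * t ^ (a₀ + γ) := le_trans (by positivity) ha₀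
  have hθ : 0 ≤ θ := nonneg_of_mul_nonneg_left (hBN.trans ha₁) (by positivity)
  have hN_split : N ^ (a₀ - a₁ * s) * N ^ γ = N ^ (a₀ + γ) * (N ^ (-a₁)) ^ s := by
    rw [← Real.rpow_mul hN.le, ← Real.rpow_add hN, ← Real.rpow_add hN]
    ring_nf
  have ht_split : t ^ (α * s + γ + a₀ - a₁ * s) =
      (t ^ α) ^ s * t ^ (a₀ + γ) * (t ^ (-a₁)) ^ s := by
    rw [← Real.rpow_mul ht.le, ← Real.rpow_mul ht.le, ← Real.rpow_add ht, ← Real.rpow_add ht]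
    ring_nf
  calc ((B * t ^ α) ^ s * (G * N ^ (a₀ - a₁ * s)) + 1) * N ^ γ
      = N ^ γ + G * (t ^ α) ^ s * N ^ (a₀ + γ) * (B * N ^ (-a₁)) ^ s := by
        rw [Real.mul_rpow hB (by positivity), Real.mul_rpow hB (by positivity)]
        linear_combination B ^ s * (t ^ α) ^ s * G * hN_split
    _ ≤ κ₁ * t ^ γ + G * (t ^ α) ^ s * (κ₂ * t ^ (a₀ + γ)) * (θ * t ^ (-a₁)) ^ s := by gcongr
    _ = κ₁ * t ^ γ + G * κ₂ * θ ^ s * t ^ (α * s + γ + a₀ - a₁ * s) := by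
        rw [ht_split, Real.mul_rpow hθ (by positivity)]
        ring

theorem mul_rpow_neg_le_rpow_neg {B D t N a : ℝ} (hD : 0 < D) (ht : 0 < t) (ha : 0 ≤ a)
    (hN : D * t ≤ N) (hB : B ≤ D ^ a) : B * N ^ (-a) ≤ t ^ (-a) := by
  have hN₀ : 0 < N := lt_of_lt_of_le (by positivity) hN
  calc B * N ^ (-a) ≤ D ^ a * (D * t) ^ (-a) := by
        gcongr ?_ * ?_
        exact Real.rpow_le_rpow_of_nonpos (by positivity) hN (by linarith)
    _ = t ^ (-a) := by
        rw [Real.mul_rpow hD.le ht.le, ← mul_assoc, ← Real.rpow_add hD, add_neg_cancel,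
          Real.rpow_zero, one_mul]

theorem exists_forall_sampleCost_le {α γ a₀ a₁ B G D D' s₀ : ℝ} (hα : 0 ≤ α) (hB : 0 ≤ B)
    (hG : 0 ≤ G) (hD : 0 < D) (hD' : 0 < D') (hBD : α < a₁ → B ≤ D ^ a₁) :
    ∃ C : ℝ, 0 < C ∧ ∀ t s N : ℝ, 0 < t → 0 ≤ s → (a₁ ≤ α → s = s₀) →
      N ∈ Set.Icc (D * t) (D' * t) →
      ((B * t ^ α) ^ s * (G * N ^ (a₀ - a₁ * s)) + 1) * N ^ γ ≤
        C * (t ^ γ + t ^ (α * s + γ + a₀ - a₁ * s)) := by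
  let κ : ℝ → ℝ := fun x => D ^ x + D' ^ x
  -- The factor `θ ^ s` has to be bounded uniformly in `s`, which is fixed only if `a₁ ≤ α`.
  let θ : ℝ := if a₁ ≤ α then B * κ (-a₁) else 1
  have hκ : ∀ x, 0 < κ x := fun x => by positivity
  have : 0 ≤ θ := by
    have := hκ (-a₁)
    dsimp only [θ]
    positivity
  have hC : 0 ≤ G * κ (a₀ + γ) * θ ^ s₀ := by
    have := hκ (a₀ + γ)
    positivity
  refine ⟨κ γ + G * κ (a₀ + γ) * θ ^ s₀, add_pos_of_pos_of_nonneg (hκ γ) hC,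
    fun t s N ht hs hs₀ hN => ?_⟩
  have hκN := rpow_le_add_mul_rpow hD hD'.le ht hN
  have hBN : B * N ^ (-a₁) ≤ θ * t ^ (-a₁) := by
    rcases le_or_gt a₁ α with h | h
    · simp only [θ, if_pos h, mul_assoc]
      gcongr
      exact hκN _
    · simp only [θ, if_neg h.not_ge, one_mul]
      exact mul_rpow_neg_le_rpow_neg hD ht (hα.trans h.le) hN.1 (hBD h)
  have hθs : θ ^ s = θ ^ s₀ := by
    rcases le_or_gt a₁ α with h | h
    · rw [hs₀ h]
    · simp only [θ, if_neg h.not_ge, Real.one_rpow]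
  have hN₀ : 0 < N := lt_of_lt_of_le (by positivity) hN.1
  have h_le := sampleCost_le (α := α) hN₀ ht hs hB hG (hκN γ) (hκN (a₀ + γ)) hBN
  rw [hθs] at h_le
  have h₁ : 0 ≤ κ γ * t ^ (α * s + γ + a₀ - a₁ * s) := mul_nonneg (hκ γ).le (by positivity)
  have h₂ : 0 ≤ G * κ (a₀ + γ) * θ ^ s₀ * t ^ γ := mul_nonneg hC (by positivity)
  linarith

theorem exists_forall_sampleCost_le_rpow_neg {α γ a₀ a₁ B G D D' s₀ : ℝ} (hα : 0 < α) (hB : 0 ≤ B)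
    (hG : 0 ≤ G) (hD : 0 < D) (hD' : 0 < D') (hBD : α < a₁ → B ≤ D ^ a₁) :
    ∃ C : ℝ, 0 < C ∧ ∀ ε s N : ℝ, 0 < ε → 0 ≤ s → (a₁ ≤ α → s = s₀) →
      N ∈ Set.Icc (D * ε ^ (-α⁻¹)) (D' * ε ^ (-α⁻¹)) →
      ((B / ε) ^ s * (G * N ^ (a₀ - a₁ * s)) + 1) * N ^ γ ≤
        C * (ε ^ (-(γ / α)) + ε ^ (-s - (γ + a₀ - a₁ * s) / α)) := by
  obtain ⟨C, hC, h⟩ := exists_forall_sampleCost_le (γ := γ) (a₀ := a₀) (s₀ := s₀) hα.le hB hG hD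
    hD' hBD
  refine ⟨C, hC, fun ε s N hε hs hs₀ hN => ?_⟩
  have h_pow : ∀ x, (ε ^ (-α⁻¹)) ^ x = ε ^ (-(x / α)) := fun x => by
    rw [← Real.rpow_mul hε.le]
    ring_nf
  have h_le := h (ε ^ (-α⁻¹)) s N (by positivity) hs hs₀ hN
  rw [h_pow, h_pow, h_pow, div_self hα.ne', Real.rpow_neg_one, ← div_eq_mul_inv] at h_le
  convert h_le using 4
  field_simp
  ring

theorem mainTheorem4_general
    (q α γ a₀ a₁ Cα Cstab Cτ Cγ A c₁ c₂ : ℝ)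
    (hq : 1 < q) (hα : 0 < α) (hCstab : 0 < Cstab) (hCτ : 0 < Cτ) (hCγ : 0 < Cγ)
    (hA : 1 < A) (hc₁ : 0 < c₁) (hc₂ : 0 < c₂) :
    ∃ C : ℝ, 0 < C ∧
      ∀ (p : ℝ), p ≤ min q 2 →
      ∀ (E : Type u) [NormedAddCommGroup E] [NormedSpace ℝ E] [CompleteSpace E]
        [MeasurableSpace E] [BorelSpace E],
      ∀ (Ω : Type v) [MeasurableSpace Ω] (P : Measure Ω) [IsProbabilityMeasure P]
        (X : Ω → E), MemLp X 1 P →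
      ∀ (V : ℕ+ → Submodule ℝ E), TypeConstantGrowth V p a₀ a₁ Cτ →
      ∀ (Xl : ∀ ℓ : ℕ+, Ω → V ℓ), (∀ ℓ, MemLp (Xl ℓ) (ENNReal.ofReal q) P) →
      ∀ (Xs : ∀ ℓ : ℕ+, ℕ → Ω → V ℓ),
      (∀ ℓ, iIndepFun (Xs ℓ) P) →
      (∀ ℓ j, IdentDistrib (Xs ℓ j) (Xl ℓ) P P) →
      (∀ ℓ, (Module.finrank ℝ (V ℓ) : ℝ) ^ α *
        ‖(∫ ω, X ω ∂P) - ∫ ω, (Xl ℓ ω : E) ∂P‖ ≤ Cα) →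
      (∀ ℓ, eLpNorm (fun ω => (Xl ℓ ω : E) - ∫ ω', (Xl ℓ ω' : E) ∂P) (ENNReal.ofReal q) P ≤
        ENNReal.ofReal Cstab) →
      (∀ ℓ : ℕ+, c₁ * A ^ (ℓ : ℕ) ≤ Module.finrank ℝ (V ℓ) ∧
        Module.finrank ℝ (V ℓ) ≤ c₂ * A ^ (ℓ : ℕ)) →
      ∀ (cost : ℕ+ → ℝ), (∀ ℓ, cost ℓ ≤ Cγ * (Module.finrank ℝ (V ℓ) : ℝ) ^ γ) →
      ∀ ε ∈ Set.Ioc (0 : ℝ) 1,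
        ∃ (L : ℕ+) (M : ℕ), 1 ≤ M ∧
          slmcError P q X (fun j ω => (Xs L j ω : E)) M < ENNReal.ofReal ε ∧
          (a₁ ≤ α → slmcCost cost L M ≤
            C * (ε ^ (-(γ / α)) +
              ε ^ (-(min q 2).conjExponent -
                (γ + a₀ - a₁ * (min q 2).conjExponent) / α))) ∧
          (α < a₁ → 1 < p → slmcCost cost L M ≤
            C * (ε ^ (-(γ / α)) +
              ε ^ (-p.conjExponent - (γ + a₀ - a₁ * p.conjExponent) / α))) := by
  have hB : 0 ≤ 6 * q * Real.exp (3 / 2) * Cstab := by positivity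
  obtain ⟨D, hD, hDα, hDa₁⟩ := exists_pos_le_rpow (β := a₁) (x := 3 * Cα)
    (y := 6 * q * Real.exp (3 / 2) * Cstab) hα
  obtain ⟨C, hC, h_cost⟩ := exists_forall_sampleCost_le_rpow_neg (γ := γ) (a₀ := a₀)
    (D' := c₂ * (A * (D / c₁ + 1))) (s₀ := (min q 2).conjExponent) hα hB hCτ.le hD
    (by positivity) fun h => hDa₁ (hα.trans h)
  refine ⟨Cγ * C, by positivity, ?_⟩
  intro p hp E _ _ _ _ _ Ω _ P _ X _ V h_growth Xl hXl Xs h_indep h_ident h_bias h_stab h_dim cost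
    h_sample ε hε
  obtain ⟨r, hr, hpr, hrq, hr_le, hr_gt⟩ := exists_typeExponent (a₁ := a₁) (α := α) hq hp
  obtain ⟨L, hL⟩ := exists_level_mem_Icc hA hc₁ hc₂.le h_dim hD.le
    (t := ε ^ (-α⁻¹)) (Real.one_le_rpow_of_pos_of_le_one_of_nonpos hε.1 hε.2
      (neg_nonpos.mpr (by positivity)))
  have h_bias_le : ‖(∫ ω, X ω ∂P) - ∫ ω, (Xl L ω : E) ∂P‖ ≤ ε / 3 :=
    le_div_of_mul_rpow_neg_inv_le hα three_pos hD hε.1 hDα hL.1 (norm_nonneg _) (h_bias L)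
  have hN : (0 : ℝ) < Module.finrank ℝ (V L) := lt_of_lt_of_le (by positivity) (h_dim L).1
  obtain ⟨M, hM, h_error, hM_le⟩ := h_growth.exists_slmcError_lt hCτ (by exact_mod_cast hN) hpr hr
    hrq hCstab hε.1 ((hXl L).integrable (by simpa using hq.le)) (h_indep L) (h_ident L) (h_stab L)
    h_bias_le
  have h_cost_le := (mul_le_mul_of_nonneg_right hM_le (by positivity)).trans
    (h_cost ε r.conjExponent _ hε.1 (Real.HolderConjugate.conjExponent hr).symm.nonneg
      (fun h => by rw [hr_le h]) hL)
  have h_slmcCost : slmcCost cost L M ≤ Cγ * C * (ε ^ (-(γ / α)) +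
      ε ^ (-r.conjExponent - (γ + a₀ - a₁ * r.conjExponent) / α)) := by
    calc slmcCost cost L M ≤ M * (Cγ * (Module.finrank ℝ (V L) : ℝ) ^ γ) :=
          mul_le_mul_of_nonneg_left (h_sample L) (by positivity)
      _ ≤ _ := by linear_combination Cγ * h_cost_le
  exact ⟨L, M, hM, h_error, fun h => hr_le h ▸ h_slmcCost, fun h hp₁ => hr_gt h hp₁ ▸ h_slmcCost⟩

theorem mainTheorem4
    (q α γ a₀ a₁ Cα Cstab Cτ Cγ A c₁ c₂ : ℝ)
    (hq : 1 < q) (hα : 0 < α) (hγ : 0 < γ) (ha₀ : 0 ≤ a₀) (ha₁ : 0 ≤ a₁)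
    (hCα : 0 < Cα) (hCstab : 0 < Cstab) (hCτ : 1 ≤ Cτ) (hCγ : 0 < Cγ)
    (hA : 1 < A) (hc₁ : 0 < c₁) (hc₂ : 0 < c₂) :
    ∃ C : ℝ, 0 < C ∧
      ∀ (p : ℝ), p ∈ Set.Icc (1 : ℝ) 2 → p ≤ q →
      ∀ (E : Type u) [NormedAddCommGroup E] [NormedSpace ℝ E] [CompleteSpace E]
        [MeasurableSpace E] [BorelSpace E],
      IsOfRademacherType E p →
      ∀ (Ω : Type v) [MeasurableSpace Ω] (P : Measure Ω) [IsProbabilityMeasure P]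
        (X : Ω → E), MemLp X 1 P →
      ∀ (V : ℕ+ → Submodule ℝ E), (∀ ℓ, FiniteDimensional ℝ (V ℓ)) →
      TypeConstantGrowth V p a₀ a₁ Cτ →
      ∀ (Xl : ∀ ℓ : ℕ+, Ω → V ℓ), (∀ ℓ, MemLp (Xl ℓ) (ENNReal.ofReal q) P) →
      ∀ (Xs : ∀ ℓ : ℕ+, ℕ → Ω → V ℓ),
      (∀ ℓ, iIndepFun (Xs ℓ) P) →
      (∀ ℓ j, IdentDistrib (Xs ℓ j) (Xl ℓ) P P) →
      (∀ ℓ, (Module.finrank ℝ (V ℓ) : ℝ) ^ α *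
        ‖(∫ ω, X ω ∂P) - ∫ ω, (Xl ℓ ω : E) ∂P‖ ≤ Cα) →
      (∀ ℓ, eLpNorm (fun ω => (Xl ℓ ω : E) - ∫ ω', (Xl ℓ ω' : E) ∂P) (ENNReal.ofReal q) P ≤
        ENNReal.ofReal Cstab) →
      (∀ ℓ : ℕ+, c₁ * A ^ (ℓ : ℕ) ≤ Module.finrank ℝ (V ℓ) ∧
        Module.finrank ℝ (V ℓ) ≤ c₂ * A ^ (ℓ : ℕ)) →
      ∀ (cost : ℕ+ → ℝ),
      (∀ ℓ, 0 ≤ cost ℓ ∧ cost ℓ ≤ Cγ * (Module.finrank ℝ (V ℓ) : ℝ) ^ γ) →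
      ∀ ε ∈ Set.Ioc (0 : ℝ) (1 / 2),
        ∃ (L : ℕ+) (M : ℕ), 1 ≤ M ∧
          slmcError P q X (fun j ω => (Xs L j ω : E)) M < ENNReal.ofReal ε ∧
          (a₁ ≤ α → slmcCost cost L M ≤
            C * (ε ^ (-(γ / α)) +
              ε ^ (-(min q 2).conjExponent -
                (γ + a₀ - a₁ * (min q 2).conjExponent) / α))) ∧
          (α < a₁ → 1 < p → slmcCost cost L M ≤
            C * (ε ^ (-(γ / α)) +
              ε ^ (-p.conjExponent - (γ + a₀ - a₁ * p.conjExponent) / α))) := by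
  obtain ⟨C, hC, h⟩ := mainTheorem4_general q α γ a₀ a₁ Cα Cstab Cτ Cγ A c₁ c₂ hq hα hCstab
    (by linarith) hCγ hA hc₁ hc₂
  exact ⟨C, hC, fun p hp hpq E _ _ _ _ _ _ Ω _ P _ X hX V _ h_growth Xl hXl Xs h_indep h_ident
    h_bias h_stab h_dim cost h_cost ε hε => h p (le_min hpq hp.2) E Ω P X hX V h_growth Xl hXl
      Xs h_indep h_ident h_bias h_stab h_dim cost (fun ℓ => (h_cost ℓ).2) ε
      ⟨hε.1, hε.2.trans (by norm_num)⟩⟩
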